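/- **Setting.** Let $\Omega$ be a (standard Borel) state space with prior $D$. An experiment is a measurable map $\sigma:\Omega\to\Delta(S)$ into the distributions over some signal space; $\sigma|\mu$ denotes the distribution over Bayesian posteriors that it induces at the belief $\mu$. An agent has a private type $\theta\in\Theta=[\underline\theta,\overline\theta]\subset[0,\infty)$, drawn from a distribution $F$ with density $f$, and obtains expected utility $V(\mu,\theta)$ from the final belief $\mu$; here $V(\cdot,\theta)$ is (integrable and) monotone in the Blackwell order for every type. The agent can conduct any experiment $\hat\sigma$ of a set $\hat\Sigma$ at cost $C(\hat\sigma,\mu)\ge 0$, depending on her current belief $\mu$; $\hat\Sigma$ contains the null experiment, which is free. Put $$V(\mu,\hat\Sigma,\theta)=\sup_{\hat\sigma\in\hat\Sigma}\Big(\mathbb E_{\hat\mu\sim\hat\sigma|\mu}[V(\hat\mu,\theta)]-C(\hat\sigma,\mu)\Big).$$ A mechanism $(\pi,p)$ assigns to each type $\theta$ a distribution $\pi(\theta)$ over experiments (the realized experiment is announced) and a payment $p(\theta)\in\mathbb R$. It is incentive compatible if $\mathbb E_{\mu\sim\pi(\theta)|D}[V(\mu,\hat\Sigma,\theta)]-p(\theta)\ge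 \mathbb E_{\mu\sim\pi(\theta')|D}[V(\mu,\hat\Sigma,\theta)]-p(\theta')$ for all $\theta,\theta'\in\Theta$, and individually rational if $\mathbb E_{\mu\sim\pi(\theta)|D}[V(\mu,\hat\Sigma,\theta)]-p(\theta)\ge V(D,\hat\Sigma,\theta)$ for all $\theta\in\Theta$. Its revenue is $\mathbb E_{\theta\sim F}[p(\theta)]$, and the optimal revenue is the supremum of the revenue over all incentive compatible and individually rational mechanisms. Posting a price $t$ for full information is the mechanism in which a type receives the experiment that reveals the state and pays $t$ if this is at least as good for her as $V(D,\hat\Sigma,\theta)$, and otherwise receives no information and pays nothing. **Assumptions.** 1. (Convex separable valuation) $V(\mu,\theta)=v(\mu)\,\theta$ for a convex function $v$ of the belief. 2. (Sequential learning) For $\hat\sigma\in\hat\Sigma$ and a measurable map $\kappa$ from the signals of $\hat\sigma$ to $\hat\Sigma$, the experiment $\hat\sigma\circ\kappa$, which first conducts $\hat\sigma$ and after the signal $s$ conducts $\kappa(s)$, belongs to $\hat\Sigma$ (up to the names of the signals), and for every belief $\mu$ $$C(\hat\sigma\circ\kappa,\mu)\le C(\hat\sigma,\mu)+\int_\Omega\int_S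 C(\kappa(s),\hat\mu_{\hat\sigma,s,\mu})\,d\hat\sigma(s|\omega)\,d\mu(\omega),$$ where $\hat\mu_{\hat\sigma,s,\mu}$ is the posterior after the signal $s$ of $\hat\sigma$ at the belief $\mu$. 3. (Regularity) $f>0$ and the virtual value $\phi(\theta)=\theta-\frac{1-F(\theta)}{f(\theta)}$ is non-decreasing on $(\underline\theta,\overline\theta)$. **Theorem.** Under these assumptions, for any prior $D$ and any cost function $C$, the optimal revenue is finite, and there is a price $t$ such that posting $t$ for full information is an incentive compatible and individually rational mechanism whose revenue is at least half of the optimal revenue. -/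

import Mathlib

open MeasureTheory ProbabilityTheory Set
open scoped ENNReal NNReal

universe u

namespace InfoSale

/-- An experiment (information structure) on the state space `Ω`: a signal space `S` and a
measurable map `σ : Ω → Δ(S)`. -/
structure Experiment (Ω : Type u) [MeasurableSpace Ω] where
  S : Type u
  [measurableSpace : MeasurableSpace S]
  kernel : Kernel Ω S
  [isMarkov : IsMarkovKernel kernel]

attribute [instance] Experiment.measurableSpace Experiment.isMarkov

/-- A randomized experiment, i.e. a distribution `π` over experiments: `x` is drawn from `law`,
independently of the state, and the realized experiment `ω ↦ kernel (ω, x)` is announced. -/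
structure RandomExperiment (Ω : Type u) [MeasurableSpace Ω] where
  X : Type u
  [measurableSpaceX : MeasurableSpace X]
  law : Measure X
  [isProb : IsProbabilityMeasure law]
  S : Type u
  [measurableSpaceS : MeasurableSpace S]
  kernel : Kernel (Ω × X) S
  [isMarkov : IsMarkovKernel kernel]

attribute [instance] RandomExperiment.measurableSpaceX RandomExperiment.isProb
  RandomExperiment.measurableSpaceS RandomExperiment.isMarkov

section Experiments

variable {Ω : Type u} [MeasurableSpace Ω]

/-- The experiment that reveals the state. -/
noncomputable def Experiment.full : Experiment Ω where
  S := Ω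
  kernel := Kernel.id

/-- The null experiment, with a single uninformative signal. -/
noncomputable def Experiment.null : Experiment Ω where
  S := PUnit.{u + 1}
  kernel := Kernel.const Ω (Measure.dirac PUnit.unit)

/-- The experiment announced when `x` is realized. -/
noncomputable def RandomExperiment.realize (R : RandomExperiment Ω) (x : R.X) : Experiment Ω where
  S := R.S
  kernel := Kernel.sectL R.kernel x

/-- The degenerate distribution at one experiment. -/
noncomputable def Experiment.toRandom (σ : Experiment Ω) : RandomExperiment Ω where
  X := PUnit.{u + 1}
  law := Measure.dirac PUnit.unit
  S := σ.S
  kernel := Kernel.prodMkRight PUnit.{u + 1} σ.kernel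

/-- Sequential learning: first conduct `σ`; after the signal `s`, conduct the experiment
`ω ↦ η (ω, s)`. Both signals are observed. -/
noncomputable def Experiment.sequential (σ : Experiment Ω) {T : Type u} [MeasurableSpace T]
    (η : Kernel (Ω × σ.S) T) [IsMarkovKernel η] : Experiment Ω where
  S := σ.S × T
  kernel := σ.kernel ⊗ₖ η

/-- The law of the signal of `σ` when the state is distributed according to `μ`. -/
noncomputable def Experiment.signalLaw (σ : Experiment Ω) (μ : ProbabilityMeasure Ω) :
    Measure σ.S :=
  (μ : Measure Ω).bind σ.kernel

variable [StandardBorelSpace Ω] [Nonempty Ω]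

/-- The Bayesian posterior belief after the signal `s` of `σ`, starting from the belief `μ`. -/
noncomputable def Experiment.posterior (σ : Experiment Ω) (μ : ProbabilityMeasure Ω) (s : σ.S) :
    ProbabilityMeasure Ω :=
  ⟨ProbabilityTheory.posterior σ.kernel (μ : Measure Ω) s, inferInstance⟩

/-- The distribution `σ | μ` over posterior beliefs induced by `σ` given the belief `μ`. -/
noncomputable def Experiment.posteriorLaw (σ : Experiment Ω) (μ : ProbabilityMeasure Ω) :
    Measure (ProbabilityMeasure Ω) :=
  (σ.signalLaw μ).map (σ.posterior μ)

/-- Two experiments carry the same information (they differ only by the names of the signals):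
under every belief they induce the same distribution over posteriors. -/
def Experiment.SameInfo (σ τ : Experiment Ω) : Prop :=
  ∀ μ : ProbabilityMeasure Ω, σ.posteriorLaw μ = τ.posteriorLaw μ

end Experiments

/-- The data of the model, with its standing assumptions.
`beliefs` is the domain of the valuation: it may be all of `Δ(Ω)`, but it may also be smaller, so
that valuations such as minus the variance on an unbounded state space are covered. -/
structure Environment (Ω : Type u) [MeasurableSpace Ω] [StandardBorelSpace Ω] [Nonempty Ω] where
  /-- the beliefs at which the agent's value is defined -/
  beliefs : Set (ProbabilityMeasure Ω)
  /-- Bayesian updating does not leave the domain -/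
  posterior_mem : ∀ μ ∈ beliefs, ∀ σ : Experiment Ω,
    ∀ᵐ s ∂(σ.signalLaw μ), σ.posterior μ s ∈ beliefs
  /-- the prior distribution `D` over states -/
  prior : ProbabilityMeasure Ω
  prior_mem : prior ∈ beliefs
  /-- the type space is `[lo, hi]` -/
  lo : ℝ
  hi : ℝ
  lo_nonneg : 0 ≤ lo
  /-- the density `f` of the type distribution -/
  density : ℝ → ℝ
  measurable_density : Measurable density
  density_nonneg : ∀ θ, 0 ≤ density θ
  lintegral_density : ∫⁻ θ in Icc lo hi, ENNReal.ofReal (density θ) = 1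
  /-- `V μ θ`: expected utility of type `θ` with final posterior belief `μ` -/
  V : ProbabilityMeasure Ω → ℝ → ℝ
  /-- `V` is monotone in the Blackwell order: information never hurts on average -/
  blackwell : ∀ θ ∈ Icc lo hi, ∀ μ ∈ beliefs, ∀ σ : Experiment Ω,
    Integrable (fun ν => V ν θ) (σ.posteriorLaw μ) ∧
      V μ θ ≤ ∫ ν, V ν θ ∂(σ.posteriorLaw μ)
  /-- the experiments that the agent can conduct -/
  feasible : Set (Experiment Ω)
  /-- `cost σ μ`: the agent's cost of conducting `σ` at the belief `μ` -/
  cost : Experiment Ω → ProbabilityMeasure Ω → ℝ≥0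
  null_mem : Experiment.null ∈ feasible
  cost_null : ∀ μ, cost Experiment.null μ = 0

/-- A direct mechanism: a distribution over experiments and a payment for every type. -/
structure Mechanism (Ω : Type u) [MeasurableSpace Ω] where
  alloc : ℝ → RandomExperiment Ω
  pay : ℝ → ℝ

namespace Environment

variable {Ω : Type u} [MeasurableSpace Ω] [StandardBorelSpace Ω] [Nonempty Ω]

/-- The type space. -/
def types (E : Environment Ω) : Set ℝ := Icc E.lo E.hi

/-- The type distribution `F`. -/
noncomputable def typeLaw (E : Environment Ω) : Measure ℝ :=
  (volume.restrict E.types).withDensity fun θ => ENNReal.ofReal (E.density θ)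

/-- The virtual value `φ(θ) = θ - (1 - F(θ)) / f(θ)`. -/
noncomputable def virtualValue (E : Environment Ω) (θ : ℝ) : ℝ :=
  θ - (1 - E.typeLaw.real (Iic θ)) / E.density θ

/-- Regularity: the virtual value is well defined (the density does not vanish) and
non-decreasing. A density is determined only up to null sets, so the endpoints play no role. -/
def Regular (E : Environment Ω) : Prop :=
  (∀ θ ∈ Ioo E.lo E.hi, 0 < E.density θ) ∧ MonotoneOn E.virtualValue (Ioo E.lo E.hi)

/-- The valuation is separable and convex: `V(μ, θ) = v(μ) θ` with `v` convex. -/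
def ConvexSeparable (E : Environment Ω) : Prop :=
  ∃ v : ProbabilityMeasure Ω → ℝ,
    (∀ μ ∈ E.beliefs, ∀ θ ∈ E.types, E.V μ θ = v μ * θ) ∧
    ∀ μ₁ ∈ E.beliefs, ∀ μ₂ ∈ E.beliefs, ∀ μ ∈ E.beliefs, ∀ t ∈ Icc (0 : ℝ) 1,
      (μ : Measure Ω) =
        ENNReal.ofReal t • (μ₁ : Measure Ω) + ENNReal.ofReal (1 - t) • (μ₂ : Measure Ω) →
      v μ ≤ t * v μ₁ + (1 - t) * v μ₂

/-- The agent's experiments are closed under sequential learning, and learning in one shot costs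
at most as much as learning sequentially. For a feasible `σ` and a map `κ` from the signals of `σ`
to feasible experiments (measurable, in the sense that a single kernel `η` implements all the
`κ s`), the set of feasible experiments contains the sequential experiment, up to the names of its
signals, at a cost of at most the cost of `σ` plus the expected cost of `κ s`. -/
def SequentialLearning (E : Environment Ω) : Prop :=
  ∀ σ ∈ E.feasible, ∀ κ : σ.S → Experiment Ω, (∀ s, κ s ∈ E.feasible) →
    ∀ (T : Type u) [MeasurableSpace T] (η : Kernel (Ω × σ.S) T) [IsMarkovKernel η],
      (∀ s, Experiment.SameInfo ⟨T, Kernel.sectL η s⟩ (κ s)) →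
      ∃ τ ∈ E.feasible, Experiment.SameInfo τ (σ.sequential η) ∧
        ∀ μ ∈ E.beliefs,
          AEMeasurable (fun s => E.cost (κ s) (σ.posterior μ s)) (σ.signalLaw μ) →
          (E.cost τ μ : ℝ≥0∞) ≤
            E.cost σ μ + ∫⁻ s, (E.cost (κ s) (σ.posterior μ s) : ℝ≥0∞) ∂(σ.signalLaw μ)

/-- `V(μ, Σ̂, θ)`: the best utility of type `θ` at the belief `μ` when she can still conduct a
feasible experiment at her own cost (a supremum, which need not be attained). -/
noncomputable def indirect (E : Environment Ω) (μ : ProbabilityMeasure Ω) (θ : ℝ) : ℝ :=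
  sSup ((fun σ : Experiment Ω => (∫ ν, E.V ν θ ∂(σ.posteriorLaw μ)) - (E.cost σ μ : ℝ)) ''
    E.feasible)

/-- Expected gross utility of type `θ` from the randomized experiment `Q`. -/
noncomputable def value (E : Environment Ω) (Q : RandomExperiment Ω) (θ : ℝ) : ℝ :=
  ∫ x, ∫ μ, E.indirect μ θ ∂((Q.realize x).posteriorLaw E.prior) ∂Q.law

/-- The expectation `E.value Q θ` is well defined. -/
def ValueDefined (E : Environment Ω) (Q : RandomExperiment Ω) (θ : ℝ) : Prop :=
  (∀ᵐ x ∂Q.law,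
    Integrable (fun μ => E.indirect μ θ) ((Q.realize x).posteriorLaw E.prior)) ∧
  Integrable (fun x => ∫ μ, E.indirect μ θ ∂((Q.realize x).posteriorLaw E.prior)) Q.law

/-- All expected utilities and the expected revenue of the mechanism are well defined. -/
def Admissible (E : Environment Ω) (M : Mechanism Ω) : Prop :=
  (∀ θ ∈ E.types, ∀ θ' ∈ E.types, E.ValueDefined (M.alloc θ') θ) ∧ Integrable M.pay E.typeLaw

/-- Incentive compatibility. -/
def IncentiveCompatible (E : Environment Ω) (M : Mechanism Ω) : Prop :=
  ∀ θ ∈ E.types, ∀ θ' ∈ E.types,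
    E.value (M.alloc θ') θ - M.pay θ' ≤ E.value (M.alloc θ) θ - M.pay θ

/-- Individual rationality: the outside option is to acquire information from the prior. -/
def IndividuallyRational (E : Environment Ω) (M : Mechanism Ω) : Prop :=
  ∀ θ ∈ E.types, E.indirect E.prior θ ≤ E.value (M.alloc θ) θ - M.pay θ

/-- The mechanisms over which the data broker optimizes. -/
def Implementable (E : Environment Ω) (M : Mechanism Ω) : Prop :=
  E.Admissible M ∧ E.IncentiveCompatible M ∧ E.IndividuallyRational M

/-- Expected revenue. -/
noncomputable def revenue (E : Environment Ω) (M : Mechanism Ω) : ℝ :=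
  ∫ θ, M.pay θ ∂E.typeLaw

/-- The revenues that the data broker can achieve. -/
def revenues (E : Environment Ω) : Set ℝ :=
  {r | ∃ M : Mechanism Ω, E.Implementable M ∧ E.revenue M = r}

/-- The optimal revenue. -/
noncomputable def optimalRevenue (E : Environment Ω) : ℝ :=
  sSup E.revenues

open Classical in
/-- Posting the deterministic price `t` for full information: a type buys if and only if this is
at least as good for her as her outside option; otherwise she gets nothing and pays nothing. -/
noncomputable def postedPrice (E : Environment Ω) (t : ℝ) : Mechanism Ω where
  alloc θ := if E.indirect E.prior θ ≤ E.value Experiment.full.toRandom θ - t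
    then Experiment.full.toRandom else Experiment.null.toRandom
  pay θ := if E.indirect E.prior θ ≤ E.value Experiment.full.toRandom θ - t then t else 0

end Environment

end InfoSale

/-! Let `q` be the upper tail of the type density, `R(x) = x q(x)`, `m` a maximiser of `R` and `r =
R(m)`; since `lo ≤ r ≤ m`, the number `r` is itself a type. Let `G` be the expected value of `v`
under full information and `U` the utility that types get from a mechanism.

Incentive compatibility makes `U` an upper envelope of convex functions of the type with slopes
between `v(D)` and `G`, so `W(θ) = Gθ - U(θ)` is concave, nondecreasing and Lipschitz. As own
experiments have nonnegative costs, the gross value of an allocation grows at least in proportion to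
the type, whence the payment is at most `W - θ W'` almost everywhere (`pay_le`). Integration by
parts turns the expectation of this bound into `W(lo) + ∫ W' R'`. Comparing `W'` with a
supergradient of `W` at `r` bounds it by `W(r)` (`integral_virtual_le`). Individual rationality at
the single type `r` gives `W(r) ≤ t`, where `t` is the surplus of full information over the outside
option of type `r`. So `t` bounds every revenue (`revenue_le`).

At the price `t` type `r` is indifferent and all higher types buy, so the revenue is at least `t
q(r)`. Concavity of the revenue curve in quantile space gives `q(r) ≥ 1/2`
(`half_le_tail_reserve_revenue`). -/

namespace InfoSale

/-! ### Upper tails and integration by parts -/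

/-- The upper tail of a density on an interval with right endpoint `hi`. -/
noncomputable def upperTail (f : ℝ → ℝ) (hi s : ℝ) : ℝ := ∫ t in s..hi, f t

section Tail

variable {f : ℝ → ℝ} {lo hi : ℝ}

theorem upperTail_absolutelyContinuous (hf : IntervalIntegrable f volume lo hi) :
    AbsolutelyContinuousOnInterval (upperTail f hi) lo hi := by
  have h := (hf.absolutelyContinuousOnInterval_intervalIntegral (c := hi) right_mem_uIcc).neg
  have e : upperTail f hi = -fun x => ∫ v in hi..x, f v :=
    funext fun s => intervalIntegral.integral_symm hi s
  rwa [e]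

theorem ae_hasDerivAt_upperTail (hf : IntervalIntegrable f volume lo hi) :
    ∀ᵐ x, x ∈ uIcc lo hi → HasDerivAt (upperTail f hi) (-f x) x := by
  filter_upwards [hf.ae_hasDerivAt_integral] with x hx hxm
  have h := (hx hxm hi right_mem_uIcc).neg
  exact h.congr_of_eventuallyEq
    (Filter.Eventually.of_forall fun s => intervalIntegral.integral_symm hi s)

/-- Integration by parts for absolutely continuous functions: the tail has derivative `-f` only
almost everywhere, as `f` need not be continuous. -/
theorem integral_deriv_mul_upperTail (hf : IntervalIntegrable f volume lo hi) {a b : ℝ}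
    (ha : a ∈ uIcc lo hi) (hb : b ∈ uIcc lo hi) {W : ℝ → ℝ}
    (hW : AbsolutelyContinuousOnInterval W lo hi) :
    ∫ x in a..b, (deriv W x * upperTail f hi x - W x * f x) =
      W b * upperTail f hi b - W a * upperTail f hi a := by
  have hsub : uIcc a b ⊆ uIcc lo hi := uIcc_subset_uIcc ha hb
  rw [← AbsolutelyContinuousOnInterval.integral_deriv_mul_eq_sub (hW.mono hsub)
    ((upperTail_absolutelyContinuous hf).mono hsub)]
  apply intervalIntegral.integral_congr_ae
  filter_upwards [ae_hasDerivAt_upperTail hf] with x hx hxm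
  rw [(hx (hsub (uIoc_subset_uIcc hxm))).deriv]
  ring

theorem upperTail_sub_upperTail (hf : IntervalIntegrable f volume lo hi) {a b : ℝ}
    (ha : a ∈ uIcc lo hi) (hb : b ∈ uIcc lo hi) :
    upperTail f hi a - upperTail f hi b = ∫ t in a..b, f t := by
  have h2 : IntervalIntegrable f volume b hi :=
    hf.mono_set (uIcc_subset_uIcc hb right_mem_uIcc)
  rw [upperTail, upperTail, sub_eq_iff_eq_add, intervalIntegral.integral_add_adjacent_intervals
    (hf.mono_set (uIcc_subset_uIcc ha hb)) h2]

/-- The integrand is the derivative of the revenue curve `x q(x)`; this is the case `W x = x` of the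
integration by parts. -/
theorem integral_upperTail_sub_mul (hf : IntervalIntegrable f volume lo hi) {a b : ℝ}
    (ha : a ∈ uIcc lo hi) (hb : b ∈ uIcc lo hi) :
    ∫ x in a..b, (upperTail f hi x - x * f x) =
      b * upperTail f hi b - a * upperTail f hi a := by
  rw [← integral_deriv_mul_upperTail hf ha hb (W := fun x => x)
    ((LipschitzWith.id.lipschitzOnWith (s := uIcc lo hi)).absolutelyContinuousOnInterval)]
  simp

theorem intervalIntegrable_upperTail_sub_mul (hf : IntervalIntegrable f volume lo hi) {a b : ℝ}
    (ha : a ∈ uIcc lo hi) (hb : b ∈ uIcc lo hi) :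
    IntervalIntegrable (fun x => upperTail f hi x - x * f x) volume a b := by
  have hsub : uIcc a b ⊆ uIcc lo hi := uIcc_subset_uIcc ha hb
  exact (((upperTail_absolutelyContinuous hf).continuousOn.mono hsub).intervalIntegrable).sub
    ((hf.mono_set hsub).continuousOn_mul continuousOn_id)

end Tail

/-! ### Supergradients of concave functions -/

section Concave

variable {W : ℝ → ℝ} {lo hi : ℝ}

/-- For `r > lo` the infimum of the slopes to the left of `r` works, since slopes to the right are
smaller. The Lipschitz bound keeps this infimum finite and supplies the slope `K` at `r = lo`, where
there are no slopes to the left. -/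
theorem exists_supergradient {K : ℝ≥0} (hc : ConcaveOn ℝ (Icc lo hi) W)
    (hK : LipschitzOnWith K W (Icc lo hi)) {r : ℝ} (hr : r ∈ Icc lo hi) :
    ∃ k, ∀ x ∈ Icc lo hi, W x ≤ W r + k * (x - r) := by
  have hlo : lo ∈ Icc lo hi := ⟨le_rfl, hr.1.trans hr.2⟩
  have hlip : ∀ x ∈ Icc lo hi, |W x - W r| ≤ K * |x - r| := fun x hx => by
    simpa [Real.dist_eq] using hK.dist_le_mul x hx r hr
  rcases hr.1.eq_or_lt with h | h
  · refine ⟨K, fun x hx => ?_⟩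
    have h1 := hlip x hx
    rw [abs_of_nonneg (show (0 : ℝ) ≤ x - r by linarith [hx.1])] at h1
    linarith [le_abs_self (W x - W r)]
  · have hbdd : BddBelow ((fun x => slope W x r) '' Ico lo r) := by
      refine ⟨-K, ?_⟩
      rintro _ ⟨x, hx, rfl⟩
      have h1 := hlip x ⟨hx.1, hx.2.le.trans hr.2⟩
      rw [abs_sub_comm x r, abs_of_pos (show (0 : ℝ) < r - x by linarith [hx.2])] at h1
      simp only [slope_def_field]
      rw [le_div_iff₀ (by linarith [hx.2])]
      linarith [le_abs_self (W x - W r)]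
    refine ⟨sInf ((fun x => slope W x r) '' Ico lo r), fun x hx => ?_⟩
    rcases lt_trichotomy x r with hxr | rfl | hxr
    · have h1 : _ ≤ slope W x r := csInf_le hbdd ⟨x, ⟨hx.1, hxr⟩, rfl⟩
      rw [slope_def_field, le_div_iff₀ (by linarith)] at h1
      linarith
    · simp
    · have h1 : slope W r x ≤ sInf ((fun x => slope W x r) '' Ico lo r) := by
        refine le_csInf ⟨_, lo, ⟨le_rfl, h⟩, rfl⟩ ?_
        rintro _ ⟨y, hy, rfl⟩
        have := hc.slope_anti_adjacent ⟨hy.1, hy.2.le.trans hr.2⟩ hx hy.2 hxr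
        simpa [slope_def_field] using this
      rw [slope_def_field, div_le_iff₀ (by linarith)] at h1
      linarith

theorem le_add_deriv_mul (hc : ConcaveOn ℝ (Icc lo hi) W) {x y : ℝ} (hx : x ∈ Icc lo hi)
    (hy : y ∈ Icc lo hi) (hd : DifferentiableAt ℝ W x) : W y ≤ W x + deriv W x * (y - x) := by
  rcases lt_trichotomy x y with h | rfl | h
  · have := hc.slope_le_deriv hx hy h hd
    rw [slope_def_field, div_le_iff₀ (by linarith)] at this
    linarith
  · simp
  · have := hc.deriv_le_slope hy hx h hd
    rw [slope_def_field, le_div_iff₀ (by linarith)] at this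
    linarith

end Concave

/-! ### Regular densities and the revenue curve -/

/-- A regular density on `[lo, hi]`, in terms of its upper tail. -/
structure RegularDensity (f : ℝ → ℝ) (lo hi : ℝ) : Prop where
  lo_nonneg : 0 ≤ lo
  lo_lt_hi : lo < hi
  integrable : IntervalIntegrable f volume lo hi
  pos : ∀ x ∈ Ioo lo hi, 0 < f x
  tail_lo : upperTail f hi lo = 1
  monotone : MonotoneOn (fun x => x - upperTail f hi x / f x) (Ioo lo hi)

namespace RegularDensity

variable {f : ℝ → ℝ} {lo hi : ℝ}

theorem uIcc_eq (h : RegularDensity f lo hi) : uIcc lo hi = Icc lo hi := uIcc_of_le h.lo_lt_hi.le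

theorem tail_lt (h : RegularDensity f lo hi) {a b : ℝ} (ha : a ∈ Icc lo hi) (hb : b ∈ Icc lo hi)
    (hab : a < b) : upperTail f hi b < upperTail f hi a := by
  rw [← h.uIcc_eq] at ha hb
  rw [← sub_pos, upperTail_sub_upperTail h.integrable ha hb]
  refine intervalIntegral.intervalIntegral_pos_of_pos_on
    (h.integrable.mono_set (uIcc_subset_uIcc ha hb)) (fun x hx => h.pos x ?_) hab
  rw [h.uIcc_eq] at ha hb
  exact ⟨ha.1.trans_lt hx.1, hx.2.trans_le hb.2⟩

theorem tail_hi (_h : RegularDensity f lo hi) : upperTail f hi hi = 0 := by simp [upperTail]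

theorem tail_nonneg (h : RegularDensity f lo hi) {a : ℝ} (ha : a ∈ Icc lo hi) :
    0 ≤ upperTail f hi a := by
  rcases ha.2.eq_or_lt with rfl | h'
  · exact h.tail_hi.ge
  · exact h.tail_hi ▸ (h.tail_lt ha ⟨h.lo_lt_hi.le, le_rfl⟩ h').le

theorem tail_le_one (h : RegularDensity f lo hi) {a : ℝ} (ha : a ∈ Icc lo hi) :
    upperTail f hi a ≤ 1 := by
  rcases ha.1.eq_or_lt with rfl | h'
  · exact h.tail_lo.le
  · exact h.tail_lo ▸ (h.tail_lt ⟨le_rfl, h.lo_lt_hi.le⟩ ha h').le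

theorem tail_sub_mul_eq (h : RegularDensity f lo hi) {x : ℝ} (hx : x ∈ Ioo lo hi) :
    upperTail f hi x - x * f x = -(x - upperTail f hi x / f x) * f x := by
  have := (h.pos x hx).ne'
  field_simp
  ring

/-- The revenue curve lies below its tangent at the left endpoint (in quantile space). -/
theorem revenue_sub_le (h : RegularDensity f lo hi) {a b : ℝ} (ha : a ∈ Ioo lo hi)
    (hb : b ∈ Icc lo hi) (hab : a ≤ b) :
    b * upperTail f hi b - a * upperTail f hi a ≤
      -(a - upperTail f hi a / f a) * (upperTail f hi a - upperTail f hi b) := by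
  have ha' : a ∈ uIcc lo hi := h.uIcc_eq ▸ Ioo_subset_Icc_self ha
  have hb' : b ∈ uIcc lo hi := h.uIcc_eq ▸ hb
  rw [upperTail_sub_upperTail h.integrable ha' hb', ← integral_upperTail_sub_mul h.integrable ha' hb',
    ← intervalIntegral.integral_const_mul]
  refine intervalIntegral.integral_mono_on_of_le_Ioo hab
    (intervalIntegrable_upperTail_sub_mul h.integrable ha' hb')
    ((h.integrable.mono_set (uIcc_subset_uIcc ha' hb')).const_mul _) fun x hx => ?_
  have hx' : x ∈ Ioo lo hi := ⟨ha.1.trans hx.1, hx.2.trans_le hb.2⟩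
  rw [h.tail_sub_mul_eq hx']
  have := h.monotone ha hx' hx.1.le
  exact mul_le_mul_of_nonneg_right (neg_le_neg this) (h.pos x hx').le

/-- The companion tangent bound, with the point of tangency at the right endpoint: on `[a, b]` the
virtual value is at most its value at `b`. -/
theorem le_revenue_sub (h : RegularDensity f lo hi) {a b : ℝ} (ha : a ∈ Icc lo hi)
    (hb : b ∈ Ioo lo hi) (hab : a ≤ b) :
    -(b - upperTail f hi b / f b) * (upperTail f hi a - upperTail f hi b) ≤
      b * upperTail f hi b - a * upperTail f hi a := by
  have hb' : b ∈ uIcc lo hi := h.uIcc_eq ▸ Ioo_subset_Icc_self hb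
  have ha' : a ∈ uIcc lo hi := h.uIcc_eq ▸ ha
  rw [upperTail_sub_upperTail h.integrable ha' hb', ← integral_upperTail_sub_mul h.integrable ha' hb',
    ← intervalIntegral.integral_const_mul]
  refine intervalIntegral.integral_mono_on_of_le_Ioo hab
    ((h.integrable.mono_set (uIcc_subset_uIcc ha' hb')).const_mul _)
    (intervalIntegrable_upperTail_sub_mul h.integrable ha' hb') fun x hx => ?_
  have hx' : x ∈ Ioo lo hi := ⟨ha.1.trans_lt hx.1, hx.2.trans hb.2⟩
  rw [h.tail_sub_mul_eq hx']
  have := h.monotone hx' hb hx.2.le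
  exact mul_le_mul_of_nonneg_right (neg_le_neg this) (h.pos x hx').le

/-- `m` is a monopoly reserve price. -/
theorem exists_reserve (h : RegularDensity f lo hi) :
    ∃ m ∈ Icc lo hi, ∀ x ∈ Icc lo hi, x * upperTail f hi x ≤ m * upperTail f hi m := by
  have hc : ContinuousOn (fun x => x * upperTail f hi x) (Icc lo hi) := by
    have := (upperTail_absolutelyContinuous h.integrable).continuousOn
    rw [h.uIcc_eq] at this
    exact continuousOn_id.mul this
  obtain ⟨m, hm, hmax⟩ := isCompact_Icc.exists_isMaxOn (nonempty_Icc.2 h.lo_lt_hi.le) hc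
  exact ⟨m, hm, fun x hx => hmax hx⟩

section Reserve

variable {m : ℝ} (hm : m ∈ Icc lo hi)
  (hmax : ∀ x ∈ Icc lo hi, x * upperTail f hi x ≤ m * upperTail f hi m)

include hm hmax

/-- With a positive virtual value at `x < m`, the tangent bound would make the revenue at `m`
strictly smaller than at `x`. -/
theorem virtual_nonpos (h : RegularDensity f lo hi) {x : ℝ} (hx : x ∈ Ioo lo hi) (hxm : x < m) :
    x - upperTail f hi x / f x ≤ 0 := by
  have h1 := h.revenue_sub_le hx hm hxm.le
  have h2 := hmax x (Ioo_subset_Icc_self hx)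
  have h3 := h.tail_lt (Ioo_subset_Icc_self hx) hm hxm
  by_contra hcon
  push Not at hcon
  nlinarith

theorem virtual_nonneg (h : RegularDensity f lo hi) {x : ℝ} (hx : x ∈ Ioo lo hi) (hxm : m < x) :
    0 ≤ x - upperTail f hi x / f x := by
  have h1 := h.le_revenue_sub hm hx hxm.le
  have h2 := hmax x (Ioo_subset_Icc_self hx)
  have h3 := h.tail_lt hm (Ioo_subset_Icc_self hx) hxm
  by_contra hcon
  push Not at hcon
  nlinarith

theorem reserve_revenue_mem (h : RegularDensity f lo hi) :
    m * upperTail f hi m ∈ Icc lo m := by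
  have h0 : 0 ≤ m := h.lo_nonneg.trans hm.1
  refine ⟨?_, mul_le_of_le_one_right h0 (h.tail_le_one hm)⟩
  simpa [h.tail_lo] using hmax lo ⟨le_rfl, h.lo_lt_hi.le⟩

/-- Under regularity, at least half of the types exceed the monopoly revenue. -/
theorem half_le_tail_reserve_revenue (h : RegularDensity f lo hi) :
    1 / 2 ≤ upperTail f hi (m * upperTail f hi m) := by
  set r := m * upperTail f hi m with hr
  obtain ⟨hr1, hr2⟩ := h.reserve_revenue_mem hm hmax
  rcases hr1.eq_or_lt with h1 | h1
  · rw [← hr] at h1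
    rw [← h1, h.tail_lo]; norm_num
  rw [← hr] at h1 hr2
  have hm0 : 0 < m := h.lo_nonneg.trans_lt (h1.trans_le hr2)
  rcases hr2.eq_or_lt with h2 | h2
  · have : upperTail f hi m = 1 := by
      have : m * upperTail f hi m = m * 1 := by rw [← hr, h2, mul_one]
      exact mul_left_cancel₀ hm0.ne' this
    rw [h2, this]; norm_num
  have hri : r ∈ Ioo lo hi := ⟨h1, h2.trans_le hm.2⟩
  have k0 := h.virtual_nonpos hm hmax hri h2
  have e1 := h.revenue_sub_le hri hm h2.le
  have e2 := h.le_revenue_sub ⟨le_rfl, h.lo_lt_hi.le⟩ hri h1.le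
  rw [h.tail_lo] at e2
  rw [← hr] at e1
  have q1 := h.tail_nonneg hm
  have q2 := h.tail_nonneg (Ioo_subset_Icc_self hri)
  have q3 := h.tail_le_one (Ioo_subset_Icc_self hri)
  have l0 := h.lo_nonneg
  set k := r - upperTail f hi r / f r
  set q := upperTail f hi r
  have rpos : 0 < r := l0.trans_lt h1
  -- In quantile space, take the tangent to the revenue curve at `q`, where the curve has height `r
  -- q`. Its slope `k` is nonpositive and it lies above height `r` at the quantile of `m`, so its
  -- height at quantile `0` is at least `r` (`e3`). At quantile `1` its height is at least `lo ≥ 0`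
  -- (`e4`). Interpolating at `q` with weights `1 - q` and `q` gives `e5`.
  have e3 : r ≤ r * q + -k * q := by nlinarith
  have e4 : -k * (1 - q) ≤ r * q := by nlinarith
  have e5 : r * (1 - q) ≤ r * q := by nlinarith
  nlinarith

/-- The virtual-surplus bound: the expected payment that a concave net value `W` can support is at
most the value of `W` at the monopoly revenue. -/
theorem integral_virtual_le (h : RegularDensity f lo hi) {W : ℝ → ℝ} {K : ℝ≥0}
    (hc : ConcaveOn ℝ (Icc lo hi) W) (hmono : MonotoneOn W (Icc lo hi))
    (hK : LipschitzOnWith K W (Icc lo hi)) :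
    IntervalIntegrable (fun x => (W x - x * deriv W x) * f x) volume lo hi ∧
      ∫ x in lo..hi, (W x - x * deriv W x) * f x ≤ W (m * upperTail f hi m) := by
  set r := m * upperTail f hi m with hr
  obtain ⟨hr1, hr2⟩ := h.reserve_revenue_mem hm hmax
  rw [← hr] at hr1 hr2
  have hrI : r ∈ Icc lo hi := ⟨hr1, hr2.trans hm.2⟩
  have hAC : AbsolutelyContinuousOnInterval W lo hi :=
    LipschitzOnWith.absolutelyContinuousOnInterval (h.uIcc_eq ▸ hK)
  have hlo : lo ∈ uIcc lo hi := left_mem_uIcc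
  have hhi : hi ∈ uIcc lo hi := right_mem_uIcc
  have hmu : m ∈ uIcc lo hi := h.uIcc_eq ▸ hm
  have hru : r ∈ uIcc lo hi := h.uIcc_eq ▸ hrI
  -- `W` need not be differentiable at `r`, so a supergradient replaces the derivative there.
  obtain ⟨k, hk⟩ := exists_supergradient hc hK hrI
  set J : ℝ → ℝ := fun x => upperTail f hi x - x * f x with hJ
  have hJint : ∀ {a b}, a ∈ uIcc lo hi → b ∈ uIcc lo hi → IntervalIntegrable J volume a b :=
    fun ha hb => intervalIntegrable_upperTail_sub_mul h.integrable ha hb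
  have hqint : IntervalIntegrable (fun x => deriv W x * upperTail f hi x) volume lo hi :=
    hAC.intervalIntegrable_deriv.mul_continuousOn
      (upperTail_absolutelyContinuous h.integrable).continuousOn
  have hWf : IntervalIntegrable (fun x => W x * f x) volume lo hi :=
    h.integrable.continuousOn_mul hAC.continuousOn
  have hKbound : ∀ x ∈ Ioo lo hi, |deriv W x| ≤ K := fun x hx => by
    simpa using norm_deriv_le_of_lipschitzOn (Icc_mem_nhds hx.1 hx.2) hK
  have hdm : AEStronglyMeasurable (deriv W) (volume.restrict (uIoc lo hi)) :=
    (stronglyMeasurable_deriv W).aestronglyMeasurable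
  have hbd : ∀ᵐ x ∂(volume.restrict (uIoc lo hi)), ‖deriv W x‖ ≤ K := by
    rw [uIoc_of_le h.lo_lt_hi.le, ← restrict_Ioo_eq_restrict_Ioc]
    exact (ae_restrict_iff' measurableSet_Ioo).2 (Filter.Eventually.of_forall hKbound)
  have hmulint : ∀ {g : ℝ → ℝ}, IntervalIntegrable g volume lo hi →
      IntervalIntegrable (fun x => deriv W x * g x) volume lo hi := fun hg => by
    rw [intervalIntegrable_iff] at hg ⊢
    exact Integrable.bdd_mul hg hdm hbd
  have hwJ : IntervalIntegrable (fun x => deriv W x * J x) volume lo hi := hmulint (hJint hlo hhi)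
  have hdf : IntervalIntegrable (fun x => deriv W x * (x * f x)) volume lo hi :=
    hmulint (h.integrable.continuousOn_mul continuousOn_id)
  -- Integration by parts moves the density onto the revenue derivative `J`; the boundary term at
  -- `hi` vanishes with the tail.
  have hmain : ∫ x in lo..hi, (W x - x * deriv W x) * f x =
      W lo + ∫ x in lo..hi, deriv W x * J x := by
    have e := integral_deriv_mul_upperTail h.integrable hlo hhi hAC
    rw [h.tail_lo, h.tail_hi, intervalIntegral.integral_sub hqint hWf] at e
    have e1 : ∫ x in lo..hi, deriv W x * J x =
        (∫ x in lo..hi, deriv W x * upperTail f hi x) - ∫ x in lo..hi, deriv W x * (x * f x) := by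
      rw [← intervalIntegral.integral_sub hqint hdf]
      congr 1; ext x; simp only [hJ]; ring
    have e2 : ∫ x in lo..hi, (W x - x * deriv W x) * f x =
        (∫ x in lo..hi, W x * f x) - ∫ x in lo..hi, deriv W x * (x * f x) := by
      rw [← intervalIntegral.integral_sub hWf hdf]
      congr 1; ext x; ring
    rw [e1, e2]; linarith
  have hdiff : ∀ᵐ x, x ∈ uIcc lo hi → DifferentiableAt ℝ W x := hAC.ae_differentiableAt
  have hderiv_nonneg : ∀ x ∈ Ioo lo hi, 0 ≤ deriv W x := fun x hx => by
    by_cases hd : DifferentiableAt ℝ W x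
    · have := le_add_deriv_mul hc (Ioo_subset_Icc_self hx) ⟨le_rfl, h.lo_lt_hi.le⟩ hd
      have h2 := hmono (a := x) (Ioo_subset_Icc_self hx) ⟨h.lo_lt_hi.le, le_rfl⟩ hx.2.le
      have h3 := le_add_deriv_mul hc (Ioo_subset_Icc_self hx) ⟨h.lo_lt_hi.le, le_rfl⟩ hd
      have := hx.2
      nlinarith
    · rw [deriv_zero_of_not_differentiableAt hd]
  -- Integrands need comparing only where `W` is differentiable, which is almost everywhere by
  -- absolute continuity.
  have hmonoAE : ∀ {a b : ℝ} {g g' : ℝ → ℝ}, a ∈ uIcc lo hi → b ∈ uIcc lo hi → a ≤ b →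
      IntervalIntegrable g volume lo hi → IntervalIntegrable g' volume lo hi →
      (∀ x ∈ Ioo a b, x ∈ Ioo lo hi → DifferentiableAt ℝ W x → g x ≤ g' x) →
      ∫ x in a..b, g x ≤ ∫ x in a..b, g' x := by
    intro a b g g' ha hb hab hg hg' hle
    have hsub := uIcc_subset_uIcc ha hb
    refine intervalIntegral.integral_mono_ae_restrict hab (hg.mono_set hsub) (hg'.mono_set hsub) ?_
    rw [Filter.EventuallyLE, ← restrict_Ioo_eq_restrict_Icc, ae_restrict_iff' measurableSet_Ioo]
    filter_upwards [hdiff] with x hx hxm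
    rw [h.uIcc_eq] at ha hb hx
    have hxI : x ∈ Ioo lo hi := ⟨ha.1.trans_lt hxm.1, hxm.2.trans_le hb.2⟩
    exact hle x hxm hxI (hx (Ioo_subset_Icc_self hxI))
  have hw : IntervalIntegrable (deriv W) volume lo hi := hAC.intervalIntegrable_deriv
  have hWr : W r = W lo + ∫ x in lo..r, deriv W x := by
    rw [(hAC.mono (uIcc_subset_uIcc hlo hru)).integral_deriv_eq_sub]; ring
  -- This is `(W' - k)(1 - J) ≥ 0`: left of `r` the derivative is at least `k`, and `J ≤ q ≤ 1`.
  have i1 : ∫ x in lo..r, deriv W x * J x ≤ ∫ x in lo..r, (deriv W x + k * J x - k) := by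
    refine hmonoAE hlo hru hr1 hwJ ((hw.add ((hJint hlo hhi).const_mul k)).sub
      intervalIntegrable_const) fun x hx hxI hd => ?_
    have hJ1 : J x ≤ 1 := by
      have := h.tail_le_one (Ioo_subset_Icc_self hxI)
      have := mul_nonneg (h.lo_nonneg.trans hxI.1.le) (h.pos x hxI).le
      simp only [hJ]; linarith
    have h1 := hk x (Ioo_subset_Icc_self hxI)
    have h2 := le_add_deriv_mul hc (Ioo_subset_Icc_self hxI) hrI hd
    have h3 : k ≤ deriv W x := by
      have := hx.2
      by_contra hcon
      push Not at hcon
      nlinarith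
    nlinarith
  -- Between `r` and `m` the derivative of `W` is at most `k`, and revenue is still increasing, so
  -- `J ≥ 0`.
  have i2 : ∫ x in r..m, deriv W x * J x ≤ ∫ x in r..m, k * J x := by
    refine hmonoAE hru hmu hr2 hwJ ((hJint hlo hhi).const_mul k) fun x hx hxI hd => ?_
    have hJ0 : 0 ≤ J x := by
      have := h.virtual_nonpos hm hmax hxI hx.2
      simp only [hJ]
      rw [h.tail_sub_mul_eq hxI]
      exact mul_nonneg (by linarith) (h.pos x hxI).le
    have h1 := hk x (Ioo_subset_Icc_self hxI)
    have h2 := le_add_deriv_mul hc (Ioo_subset_Icc_self hxI) hrI hd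
    have h3 : deriv W x ≤ k := by
      have := hx.1
      by_contra hcon
      push Not at hcon
      nlinarith
    exact mul_le_mul_of_nonneg_right h3 hJ0
  have i3 : ∫ x in m..hi, deriv W x * J x ≤ ∫ x in m..hi, (0 : ℝ) := by
    refine hmonoAE hmu hhi hm.2 hwJ intervalIntegrable_const fun x hx hxI hd => ?_
    have hJ0 : J x ≤ 0 := by
      have := h.virtual_nonneg hm hmax hxI hx.1
      simp only [hJ]
      rw [h.tail_sub_mul_eq hxI]
      exact mul_nonpos_of_nonpos_of_nonneg (by linarith) (h.pos x hxI).le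
    exact mul_nonpos_of_nonneg_of_nonpos (hderiv_nonneg x hxI) hJ0
  have hs : ∀ {a b}, a ∈ uIcc lo hi → b ∈ uIcc lo hi →
      IntervalIntegrable (fun x => deriv W x * J x) volume a b :=
    fun ha hb => hwJ.mono_set (uIcc_subset_uIcc ha hb)
  have hsplit : ∫ x in lo..hi, deriv W x * J x = (∫ x in lo..r, deriv W x * J x) +
      (∫ x in r..m, deriv W x * J x) + ∫ x in m..hi, deriv W x * J x := by
    rw [intervalIntegral.integral_add_adjacent_intervals (hs hlo hru) (hs hru hmu),
      intervalIntegral.integral_add_adjacent_intervals (hs hlo hmu) (hs hmu hhi)]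
  refine ⟨(hWf.sub hdf).congr (fun x _ => by ring), ?_⟩
  have hsub := uIcc_subset_uIcc hlo hru
  rw [intervalIntegral.integral_sub ((hw.mono_set hsub).add ((hJint hlo hru).const_mul k))
    intervalIntegrable_const, intervalIntegral.integral_add (hw.mono_set hsub)
    ((hJint hlo hru).const_mul k), intervalIntegral.integral_const_mul,
    integral_upperTail_sub_mul h.integrable hlo hru, h.tail_lo] at i1
  rw [intervalIntegral.integral_const_mul, integral_upperTail_sub_mul h.integrable hru hmu,
    ← hr] at i2
  simp only [intervalIntegral.integral_const, smul_eq_mul, mul_zero] at i1 i3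
  rw [hmain, hsplit, hWr]
  -- The multiples of `k` add up to `k (m q(m) - lo) - k (r - lo)`, which is zero exactly because `r
  -- = m q(m)`; only `W r` remains.
  nlinarith

end Reserve

end RegularDensity

/-! ### Measurability of the space of beliefs -/

section Beliefs

variable {Ω : Type u} [MeasurableSpace Ω]

/-- A countable algebra generating the σ-algebra is a π-system, so the measures of its members
determine a belief. This separation is what makes `diracProba` a measurable embedding. -/
instance countablySeparated_probabilityMeasure [MeasurableSpace.CountablyGenerated Ω] :
    MeasurableSpace.CountablySeparated (ProbabilityMeasure Ω) := by
  set G := generateSetAlgebra (MeasurableSpace.countableGeneratingSet Ω) with hG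
  have hGc : G.Countable :=
    countable_generateSetAlgebra (MeasurableSpace.countable_countableGeneratingSet)
  have hGgen : ‹MeasurableSpace Ω› = MeasurableSpace.generateFrom G := by
    rw [hG, generateFrom_generateSetAlgebra_eq,
      MeasurableSpace.generateFrom_countableGeneratingSet]
  have hpi : IsPiSystem G := fun s hs t ht _ => isSetAlgebra_generateSetAlgebra.inter_mem hs ht
  have hmeas : ∀ s ∈ G, MeasurableSet s := fun s hs => by
    rw [hGgen]; exact MeasurableSpace.measurableSet_generateFrom hs
  have : Countable G := hGc.to_subtype
  let F : ProbabilityMeasure Ω → G → ℝ≥0∞ := fun ν A => (ν : Measure Ω) A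
  have hF : Measurable F := measurable_pi_lambda _ fun A =>
    (Measure.measurable_coe (hmeas A A.2)).comp measurable_subtype_coe
  have hinj : Function.Injective F := fun μ ν h => by
    apply Subtype.ext
    change (μ : Measure Ω) = (ν : Measure Ω)
    exact ext_of_generate_finite G hGgen hpi (fun s hs => congrFun h ⟨s, hs⟩) (by simp)
  obtain ⟨f, hf, hfi⟩ :=
    MeasurableSpace.measurable_injection_nat_bool_of_countablySeparated (G → ℝ≥0∞)
  refine ⟨⟨range fun n : ℕ => {ν | f (F ν) n = true}, countable_range _, ?_, ?_⟩⟩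
  · rintro _ ⟨n, rfl⟩
    exact ((measurable_pi_apply n).comp (hf.comp hF)) (measurableSet_singleton true)
  · intro x _ y _ h
    refine hinj (hfi (funext fun n => ?_))
    exact Bool.eq_iff_iff.2 (h _ ⟨n, rfl⟩)

instance measurableSingletonClass_probabilityMeasure [MeasurableSpace.CountablyGenerated Ω] :
    MeasurableSingletonClass (ProbabilityMeasure Ω) :=
  MeasurableSpace.measurableSingletonClass_of_countablySeparated

theorem eq_diracProba_of_ae_eq [MeasurableSingletonClass Ω] {ν : ProbabilityMeasure Ω} {ω : Ω}
    (h : ∀ᵐ x ∂(ν : Measure Ω), x = ω) : ν = diracProba ω := by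
  apply Subtype.ext
  change (ν : Measure Ω) = Measure.dirac ω
  have h1 : (ν : Measure Ω).map id = (ν : Measure Ω).map fun _ => ω := Measure.map_congr h
  rw [Measure.map_id, Measure.map_const] at h1
  simpa using h1

theorem measurableEmbedding_diracProba [StandardBorelSpace Ω] :
    MeasurableEmbedding (diracProba : Ω → ProbabilityMeasure Ω) := by
  have h : Measurable (diracProba : Ω → ProbabilityMeasure Ω) :=
    Measurable.subtype_mk Measure.measurable_dirac
  exact h.measurableEmbedding injective_diracProba

theorem integrable_integral_of_comp {α β : Type*} [MeasurableSpace α] [MeasurableSpace β]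
    {μ : Measure α} {κ : Kernel α β} {g : β → ℝ}
    (hg : Integrable g (κ ∘ₘ μ)) : Integrable (fun x => ∫ y, g y ∂κ x) μ := by
  rw [Measure.comp_eq_comp_const_apply] at hg
  exact hg.integral_comp

theorem integral_integral_of_comp {α β : Type*} [MeasurableSpace α] [MeasurableSpace β]
    {μ : Measure α} {κ : Kernel α β} {g : β → ℝ}
    (hg : Integrable g (κ ∘ₘ μ)) : ∫ x, ∫ y, g y ∂κ x ∂μ = ∫ y, g y ∂(κ ∘ₘ μ) := by
  rw [Measure.comp_eq_comp_const_apply] at hg ⊢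
  exact (Kernel.integral_comp hg).symm

end Beliefs

/-! ### Posteriors as a martingale -/

namespace Experiment

variable {Ω : Type u} [MeasurableSpace Ω]

instance isProbabilityMeasure_signalLaw (σ : Experiment Ω) (μ : ProbabilityMeasure Ω) :
    IsProbabilityMeasure (σ.signalLaw μ) := by
  unfold signalLaw; infer_instance

theorem realize_toRandom (σ : Experiment Ω) (x : PUnit.{u + 1}) : σ.toRandom.realize x = σ := by
  cases σ
  rfl

theorem signalLaw_full (μ : ProbabilityMeasure Ω) :
    (full : Experiment Ω).signalLaw μ = (μ : Measure Ω) :=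
  Measure.id_comp

variable [StandardBorelSpace Ω] [Nonempty Ω]

theorem measurable_posterior (σ : Experiment Ω) (μ : ProbabilityMeasure Ω) :
    Measurable (σ.posterior μ) :=
  (Kernel.measurable _).subtype_mk

theorem integrable_comp_posterior {σ : Experiment Ω} {μ : ProbabilityMeasure Ω}
    {g : ProbabilityMeasure Ω → ℝ} (hg : Integrable g (σ.posteriorLaw μ)) :
    Integrable (fun s => g (σ.posterior μ s)) (σ.signalLaw μ) :=
  hg.comp_measurable (σ.measurable_posterior μ)

theorem integral_posteriorLaw {σ : Experiment Ω} {μ : ProbabilityMeasure Ω}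
    {g : ProbabilityMeasure Ω → ℝ} (hg : Integrable g (σ.posteriorLaw μ)) :
    ∫ ν, g ν ∂(σ.posteriorLaw μ) = ∫ s, g (σ.posterior μ s) ∂(σ.signalLaw μ) :=
  integral_map (σ.measurable_posterior μ).aemeasurable hg.1

/-- The martingale property of beliefs. -/
theorem posterior_comp_signalLaw (σ : Experiment Ω) (μ : ProbabilityMeasure Ω) :
    (ProbabilityTheory.posterior σ.kernel (μ : Measure Ω)) ∘ₘ (σ.signalLaw μ) = (μ : Measure Ω) :=
  posterior_comp_self

theorem integrable_integral_posterior {g : Ω → ℝ} (σ : Experiment Ω) {μ : ProbabilityMeasure Ω}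
    (hg : Integrable g (μ : Measure Ω)) :
    Integrable (fun s => ∫ ω, g ω ∂(σ.posterior μ s : Measure Ω)) (σ.signalLaw μ) :=
  integrable_integral_of_comp ((σ.posterior_comp_signalLaw μ).symm ▸ hg)

theorem integral_integral_posterior {g : Ω → ℝ} (σ : Experiment Ω) {μ : ProbabilityMeasure Ω}
    (hg : Integrable g (μ : Measure Ω)) :
    ∫ s, ∫ ω, g ω ∂(σ.posterior μ s : Measure Ω) ∂(σ.signalLaw μ) = ∫ ω, g ω ∂(μ : Measure Ω) := by
  have h := integral_integral_of_comp (g := g) ((σ.posterior_comp_signalLaw μ).symm ▸ hg)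
  rw [σ.posterior_comp_signalLaw μ] at h
  exact h

theorem posterior_full (μ : ProbabilityMeasure Ω) :
    ∀ᵐ ω ∂(μ : Measure Ω), (full : Experiment Ω).posterior μ ω = diracProba ω := by
  filter_upwards [posterior_id (μ : Measure Ω)] with ω hω
  exact Subtype.ext (Eq.trans hω (Kernel.id_apply (α := Ω) ω))

theorem posteriorLaw_full (μ : ProbabilityMeasure Ω) :
    (full : Experiment Ω).posteriorLaw μ = (μ : Measure Ω).map diracProba := by
  rw [posteriorLaw, signalLaw_full]
  exact Measure.map_congr (posterior_full μ)

theorem posteriorLaw_of_signalLaw_eq_dirac {σ : Experiment Ω} {μ : ProbabilityMeasure Ω} {s : σ.S}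
    (h : σ.signalLaw μ = Measure.dirac s) : σ.posteriorLaw μ = Measure.dirac μ := by
  rw [posteriorLaw, h, Measure.map_dirac' (σ.measurable_posterior μ)]
  congr 1
  apply Subtype.ext
  have h2 := σ.posterior_comp_signalLaw μ
  rw [h, Measure.dirac_bind (Kernel.measurable _)] at h2
  exact h2

theorem posteriorLaw_null (μ : ProbabilityMeasure Ω) :
    (null : Experiment Ω).posteriorLaw μ = Measure.dirac μ := by
  refine posteriorLaw_of_signalLaw_eq_dirac (s := PUnit.unit) ?_
  change (μ : Measure Ω).bind (fun _ => Measure.dirac PUnit.unit) = _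
  rw [Measure.bind_const]
  simp only [measure_univ, one_smul]
  rfl

/-- The posteriors average to a point mass, so almost every one of them is concentrated at the same
point. -/
theorem posteriorLaw_diracProba (σ : Experiment Ω) (ω : Ω) :
    σ.posteriorLaw (diracProba ω) = Measure.dirac (diracProba ω) := by
  have h : ∀ᵐ s ∂(σ.signalLaw (diracProba ω)), σ.posterior (diracProba ω) s = diracProba ω := by
    have h1 : ∀ᵐ x ∂(ProbabilityTheory.posterior σ.kernel ((diracProba ω : ProbabilityMeasure Ω) :
        Measure Ω) ∘ₘ σ.signalLaw (diracProba ω)), x = ω := by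
      rw [posterior_comp_signalLaw]
      exact (ae_dirac_iff (measurableSet_singleton ω)).2 rfl
    filter_upwards [Measure.ae_ae_of_ae_comp h1] with s hs
    exact eq_diracProba_of_ae_eq hs
  rw [posteriorLaw, Measure.map_congr h, Measure.map_const]
  simp

end Experiment

/-! ### Indirect utility as a supremum of affine functions of the type -/

namespace Environment

variable {Ω : Type u} [MeasurableSpace Ω] [StandardBorelSpace Ω] [Nonempty Ω]
  {E : Environment Ω} {v : ProbabilityMeasure Ω → ℝ}

/-- The expected value of `v` at the posterior belief after `σ`. -/
noncomputable def gain (v : ProbabilityMeasure Ω → ℝ) (σ : Experiment Ω)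
    (μ : ProbabilityMeasure Ω) : ℝ := ∫ s, v (σ.posterior μ s) ∂σ.signalLaw μ

/-- The expected value of `v` once the state is known. -/
noncomputable def fullGain (v : ProbabilityMeasure Ω → ℝ) (μ : ProbabilityMeasure Ω) : ℝ :=
  ∫ ω, v (diracProba ω) ∂(μ : Measure Ω)

/-- The valuation is `v μ * θ` on the domain of the model. -/
def Separable (E : Environment Ω) (v : ProbabilityMeasure Ω → ℝ) : Prop :=
  ∀ μ ∈ E.beliefs, ∀ θ ∈ E.types, E.V μ θ = v μ * θ

theorem lo_lt_hi (E : Environment Ω) : E.lo < E.hi := by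
  by_contra h
  push Not at h
  have h1 := E.lintegral_density
  have h2 : volume (Icc E.lo E.hi) = 0 := by simp [Real.volume_Icc, h]
  rw [Measure.restrict_eq_zero.2 h2] at h1
  simp at h1

theorem hi_pos (E : Environment Ω) : 0 < E.hi := E.lo_nonneg.trans_lt E.lo_lt_hi

theorem hi_mem (E : Environment Ω) : E.hi ∈ E.types := ⟨E.lo_lt_hi.le, le_rfl⟩

theorem types_nonneg {θ : ℝ} (hθ : θ ∈ E.types) : 0 ≤ θ := E.lo_nonneg.trans hθ.1

theorem gain_full (μ : ProbabilityMeasure Ω) :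
    gain v Experiment.full μ = fullGain v μ := by
  rw [gain, fullGain, Experiment.signalLaw_full]
  refine integral_congr_ae ?_
  filter_upwards [Experiment.posterior_full μ] with ω hω
  exact congrArg v hω

theorem integral_combination {X : Type*} [MeasurableSpace X] {P : Measure X} {f g h : X → ℝ}
    (hf : Integrable f P) (hg : Integrable g P) (hh : Integrable h P) (a b c : ℝ) :
    Integrable (fun x => a * f x + b * g x + c * h x) P ∧
      ∫ x, (a * f x + b * g x + c * h x) ∂P =
        a * ∫ x, f x ∂P + b * ∫ x, g x ∂P + c * ∫ x, h x ∂P := by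
  have i₁ : Integrable (fun x => a * f x) P := hf.const_mul a
  have i₂ : Integrable (fun x => b * g x) P := hg.const_mul b
  have i₃ : Integrable (fun x => c * h x) P := hh.const_mul c
  have i₄ : Integrable (fun x => a * f x + b * g x) P := i₁.add i₂
  refine ⟨i₄.add i₃, ?_⟩
  rw [integral_add i₄ i₃, integral_add i₁ i₂, integral_const_mul, integral_const_mul,
    integral_const_mul]

section Separable

variable (hv : E.Separable v)
include hv

/-- Integrability of `V` is divided by the type; `hi` is used because it is positive, whereas `lo`
may be zero. -/
theorem integrable_posterior {μ : ProbabilityMeasure Ω} (hμ : μ ∈ E.beliefs) (σ : Experiment Ω) :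
    Integrable (fun s => v (σ.posterior μ s)) (σ.signalLaw μ) := by
  have h := Experiment.integrable_comp_posterior (E.blackwell E.hi E.hi_mem μ hμ σ).1
  refine (h.div_const E.hi).congr ?_
  filter_upwards [E.posterior_mem μ hμ σ] with s hs
  rw [hv _ hs _ E.hi_mem, mul_div_cancel_right₀ _ E.hi_pos.ne']

theorem integral_V_posteriorLaw {μ : ProbabilityMeasure Ω} (hμ : μ ∈ E.beliefs)
    (σ : Experiment Ω) {θ : ℝ} (hθ : θ ∈ E.types) :
    ∫ ν, E.V ν θ ∂(σ.posteriorLaw μ) = gain v σ μ * θ := by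
  rw [Experiment.integral_posteriorLaw (E.blackwell θ hθ μ hμ σ).1, gain, ← integral_mul_const]
  refine integral_congr_ae ?_
  filter_upwards [E.posterior_mem μ hμ σ] with s hs
  exact hv _ hs _ hθ

theorem le_gain {μ : ProbabilityMeasure Ω} (hμ : μ ∈ E.beliefs) (σ : Experiment Ω) :
    v μ ≤ gain v σ μ := by
  have h := (E.blackwell E.hi E.hi_mem μ hμ σ).2
  rw [integral_V_posteriorLaw hv hμ σ E.hi_mem, hv μ hμ _ E.hi_mem] at h
  exact le_of_mul_le_mul_right h E.hi_pos

theorem integrable_diracProba {μ : ProbabilityMeasure Ω} (hμ : μ ∈ E.beliefs) :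
    Integrable (fun ω => v (diracProba ω)) (μ : Measure Ω) := by
  have h := integrable_posterior hv hμ Experiment.full
  rw [Experiment.signalLaw_full] at h
  refine h.congr ?_
  filter_upwards [Experiment.posterior_full μ] with ω hω
  exact congrArg v hω

theorem le_fullGain {μ : ProbabilityMeasure Ω} (hμ : μ ∈ E.beliefs) : v μ ≤ fullGain v μ :=
  gain_full μ ▸ le_gain hv hμ Experiment.full

theorem integrable_fullGain_posterior {μ : ProbabilityMeasure Ω} (hμ : μ ∈ E.beliefs)
    (σ : Experiment Ω) :
    Integrable (fun s => fullGain v (σ.posterior μ s)) (σ.signalLaw μ) :=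
  σ.integrable_integral_posterior (integrable_diracProba hv hμ)

theorem integral_fullGain_posterior {μ : ProbabilityMeasure Ω} (hμ : μ ∈ E.beliefs)
    (σ : Experiment Ω) :
    ∫ s, fullGain v (σ.posterior μ s) ∂(σ.signalLaw μ) = fullGain v μ :=
  σ.integral_integral_posterior (integrable_diracProba hv hμ)

/-- `fullGain v` is linear in the belief, hence preserved on average by updating, and it dominates
`v` at every posterior in the domain. -/
theorem gain_le_fullGain {μ : ProbabilityMeasure Ω} (hμ : μ ∈ E.beliefs) (σ : Experiment Ω) :
    gain v σ μ ≤ fullGain v μ := by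
  rw [← integral_fullGain_posterior hv hμ σ]
  refine integral_mono_ae (integrable_posterior hv hμ σ) (integrable_fullGain_posterior hv hμ σ) ?_
  filter_upwards [E.posterior_mem μ hμ σ] with s hs
  exact le_fullGain hv hs

/-- The indirect utility is the least upper bound of the affine functions that the feasible
experiments generate. -/
theorem isLUB_indirect {μ : ProbabilityMeasure Ω} (hμ : μ ∈ E.beliefs) {θ : ℝ}
    (hθ : θ ∈ E.types) :
    IsLUB ((fun σ => gain v σ μ * θ - (E.cost σ μ : ℝ)) '' E.feasible) (E.indirect μ θ) := by
  have e : (fun σ : Experiment Ω => (∫ ν, E.V ν θ ∂(σ.posteriorLaw μ)) - (E.cost σ μ : ℝ)) ''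
      E.feasible = (fun σ => gain v σ μ * θ - (E.cost σ μ : ℝ)) '' E.feasible :=
    image_congr fun σ _ => by rw [integral_V_posteriorLaw hv hμ σ hθ]
  rw [indirect, e]
  refine isLUB_csSup ⟨_, Experiment.null, E.null_mem, rfl⟩ ⟨fullGain v μ * θ, ?_⟩
  rintro _ ⟨σ, -, rfl⟩
  have := mul_le_mul_of_nonneg_right (gain_le_fullGain hv hμ σ) (types_nonneg hθ)
  have := (E.cost σ μ).coe_nonneg
  simp only
  linarith

theorem le_indirect {μ : ProbabilityMeasure Ω} (hμ : μ ∈ E.beliefs) {θ : ℝ} (hθ : θ ∈ E.types)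
    {σ : Experiment Ω} (hσ : σ ∈ E.feasible) :
    gain v σ μ * θ - (E.cost σ μ : ℝ) ≤ E.indirect μ θ :=
  (isLUB_indirect hv hμ hθ).1 ⟨σ, hσ, rfl⟩

theorem indirect_le {μ : ProbabilityMeasure Ω} (hμ : μ ∈ E.beliefs) {θ : ℝ} (hθ : θ ∈ E.types)
    {B : ℝ} (hB : ∀ σ ∈ E.feasible, gain v σ μ * θ - (E.cost σ μ : ℝ) ≤ B) :
    E.indirect μ θ ≤ B := by
  refine (isLUB_indirect hv hμ hθ).2 ?_
  rintro _ ⟨σ, hσ, rfl⟩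
  exact hB σ hσ

theorem indirect_le_fullGain_mul {μ : ProbabilityMeasure Ω} (hμ : μ ∈ E.beliefs) {θ : ℝ}
    (hθ : θ ∈ E.types) : E.indirect μ θ ≤ fullGain v μ * θ :=
  indirect_le hv hμ hθ fun σ _ => by
    have := mul_le_mul_of_nonneg_right (gain_le_fullGain hv hμ σ) (types_nonneg hθ)
    have := (E.cost σ μ).coe_nonneg
    linarith

theorem indirect_sub_le {μ : ProbabilityMeasure Ω} (hμ : μ ∈ E.beliefs) {θ θ' : ℝ}
    (hθ : θ ∈ E.types) (hθ' : θ' ∈ E.types) (h : θ ≤ θ') :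
    E.indirect μ θ' ≤ E.indirect μ θ + fullGain v μ * (θ' - θ) :=
  indirect_le hv hμ hθ' fun σ hσ => by
    have h1 := mul_le_mul_of_nonneg_right (gain_le_fullGain hv hμ σ) (sub_nonneg.2 h)
    have h2 := le_indirect hv hμ hθ hσ
    linarith

theorem le_indirect_sub {μ : ProbabilityMeasure Ω} (hμ : μ ∈ E.beliefs) {θ θ' : ℝ}
    (hθ : θ ∈ E.types) (hθ' : θ' ∈ E.types) (h : θ ≤ θ') :
    E.indirect μ θ ≤ E.indirect μ θ' - v μ * (θ' - θ) :=
  indirect_le hv hμ hθ fun σ hσ => by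
    have h1 := mul_le_mul_of_nonneg_right (le_gain hv hμ σ) (sub_nonneg.2 h)
    have h2 := le_indirect hv hμ hθ' hσ
    linarith

/-- The affine functions under the supremum have nonpositive intercepts `-cost`, so each of them
divided by the type is nondecreasing, and so is their supremum. -/
theorem mul_indirect_le {μ : ProbabilityMeasure Ω} (hμ : μ ∈ E.beliefs) {θ θ' : ℝ}
    (hθ : θ ∈ E.types) (hθ' : θ' ∈ E.types) (h0 : 0 < θ) (h : θ ≤ θ') :
    E.indirect μ θ * θ' ≤ E.indirect μ θ' * θ := by
  have h0' : 0 < θ' := h0.trans_le h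
  rw [← le_div_iff₀ h0']
  refine indirect_le hv hμ hθ fun σ hσ => ?_
  rw [le_div_iff₀ h0']
  have h2 := mul_le_mul_of_nonneg_right (le_indirect hv hμ hθ' hσ) h0.le
  have h3 := mul_le_mul_of_nonneg_left h (E.cost σ μ).coe_nonneg
  linarith

theorem indirect_convex {μ : ProbabilityMeasure Ω} (hμ : μ ∈ E.beliefs) {θ θ' a b : ℝ}
    (hθ : θ ∈ E.types) (hθ' : θ' ∈ E.types) (ha : 0 ≤ a) (hb : 0 ≤ b) (hab : a + b = 1) :
    E.indirect μ (a * θ + b * θ') ≤ a * E.indirect μ θ + b * E.indirect μ θ' := by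
  refine indirect_le hv hμ ((convex_Icc E.lo E.hi) hθ hθ' ha hb hab) fun σ hσ => ?_
  have h1 := mul_le_mul_of_nonneg_left (le_indirect hv hμ hθ hσ) ha
  have h2 := mul_le_mul_of_nonneg_left (le_indirect hv hμ hθ' hσ) hb
  have h3 : (E.cost σ μ : ℝ) = a * E.cost σ μ + b * E.cost σ μ := by rw [← add_mul, hab, one_mul]
  simp only [smul_eq_mul]
  linarith

/-- A linear inequality between indirect utilities at all beliefs passes to the expected values of
a randomized experiment. -/
theorem value_combination_le {Q : RandomExperiment Ω} {θ₁ θ₂ θ₃ a b c d e : ℝ}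
    (h₁ : E.ValueDefined Q θ₁) (h₂ : E.ValueDefined Q θ₂) (h₃ : E.ValueDefined Q θ₃) (he : 0 ≤ e)
    (h : ∀ μ ∈ E.beliefs, a * E.indirect μ θ₁ + b * E.indirect μ θ₂ + c * E.indirect μ θ₃ ≤
      d * fullGain v μ - e * v μ) :
    a * E.value Q θ₁ + b * E.value Q θ₂ + c * E.value Q θ₃ ≤
      d * fullGain v E.prior - e * v E.prior := by
  obtain ⟨hI, hE⟩ := integral_combination h₁.2 h₂.2 h₃.2 a b c
  have hconst : d * fullGain v E.prior - e * v E.prior =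
      ∫ _x, (d * fullGain v E.prior - e * v E.prior) ∂Q.law := by simp
  simp only [value]
  rw [← hE, hconst]
  refine integral_mono_ae hI (integrable_const _) ?_
  filter_upwards [h₁.1, h₂.1, h₃.1] with x x₁ x₂ x₃
  obtain ⟨jI, jE⟩ := integral_combination (Experiment.integrable_comp_posterior x₁)
    (Experiment.integrable_comp_posterior x₂) (Experiment.integrable_comp_posterior x₃) a b c
  have jf := (integrable_fullGain_posterior hv E.prior_mem (Q.realize x)).const_mul d
  have jv := (integrable_posterior hv E.prior_mem (Q.realize x)).const_mul e
  rw [Experiment.integral_posteriorLaw x₁, Experiment.integral_posteriorLaw x₂,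
    Experiment.integral_posteriorLaw x₃, ← jE]
  have hle := integral_mono_ae jI (jf.sub jv) (by
    filter_upwards [E.posterior_mem E.prior E.prior_mem (Q.realize x)] with s hs
    exact h _ hs)
  refine hle.trans ?_
  simp only [Pi.sub_apply]
  rw [integral_sub jf jv, integral_const_mul, integral_const_mul,
    integral_fullGain_posterior hv E.prior_mem]
  -- The `fullGain` term is preserved exactly by updating, while `v` can only grow on average; here
  -- the sign of `e` matters.
  exact sub_le_sub_left (mul_le_mul_of_nonneg_left (le_gain hv E.prior_mem _) he) _

end Separable

/-- At a degenerate belief there is nothing left to learn. -/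
theorem indirect_diracProba (E : Environment Ω) (ω : Ω) (θ : ℝ) :
    E.indirect (diracProba ω) θ = E.V (diracProba ω) θ := by
  have e : ∀ σ : Experiment Ω, ∫ ν, E.V ν θ ∂(σ.posteriorLaw (diracProba ω)) =
      E.V (diracProba ω) θ := fun σ => by
    rw [Experiment.posteriorLaw_diracProba, integral_dirac]
  refine IsGreatest.csSup_eq ⟨⟨Experiment.null, E.null_mem, ?_⟩, ?_⟩
  · simp [e, E.cost_null]
  · rintro _ ⟨σ, -, rfl⟩
    simp [e]

/-- Full information leads to point beliefs, where nothing is left to learn. The measurable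
embedding transfers this without measurability of `E.indirect`. -/
theorem indirect_ae_eq_full (E : Environment Ω) (θ : ℝ) (μ : ProbabilityMeasure Ω) :
    (fun ν => E.indirect ν θ) =ᵐ[(Experiment.full : Experiment Ω).posteriorLaw μ]
      fun ν => E.V ν θ := by
  rw [Experiment.posteriorLaw_full]
  refine measurableEmbedding_diracProba.ae_map_iff.2 (Filter.Eventually.of_forall fun ω => ?_)
  exact E.indirect_diracProba ω θ

theorem valueDefined_toRandom {σ : Experiment Ω} {θ : ℝ}
    (h : Integrable (fun μ => E.indirect μ θ) (σ.posteriorLaw E.prior)) :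
    E.ValueDefined σ.toRandom θ := by
  refine ⟨Filter.Eventually.of_forall fun x => ?_, ?_⟩
  · rw [σ.realize_toRandom x]; exact h
  · have e : (fun x : σ.toRandom.X => ∫ μ, E.indirect μ θ
        ∂((σ.toRandom.realize x).posteriorLaw E.prior)) =
        fun _ => ∫ μ, E.indirect μ θ ∂(σ.posteriorLaw E.prior) :=
      funext fun x => by rw [σ.realize_toRandom x]
    rw [e]
    exact integrable_const _

theorem value_toRandom (σ : Experiment Ω) (θ : ℝ) :
    E.value σ.toRandom θ = ∫ μ, E.indirect μ θ ∂(σ.posteriorLaw E.prior) := by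
  have e : (fun x : σ.toRandom.X => ∫ μ, E.indirect μ θ
      ∂((σ.toRandom.realize x).posteriorLaw E.prior)) =
      fun _ => ∫ μ, E.indirect μ θ ∂(σ.posteriorLaw E.prior) :=
    funext fun x => by rw [σ.realize_toRandom x]
  rw [value, e]
  simp

theorem valueDefined_full {θ : ℝ} (hθ : θ ∈ E.types) :
    E.ValueDefined Experiment.full.toRandom θ :=
  valueDefined_toRandom <| (E.blackwell θ hθ _ E.prior_mem _).1.congr
    (E.indirect_ae_eq_full θ _).symm

theorem valueDefined_null (θ : ℝ) : E.ValueDefined Experiment.null.toRandom θ := by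
  refine valueDefined_toRandom ?_
  rw [Experiment.posteriorLaw_null]
  exact integrable_dirac (by simp)

theorem value_null (θ : ℝ) :
    E.value Experiment.null.toRandom θ = E.indirect E.prior θ := by
  rw [value_toRandom, Experiment.posteriorLaw_null, integral_dirac]

theorem value_full (hv : E.Separable v) {θ : ℝ} (hθ : θ ∈ E.types) :
    E.value Experiment.full.toRandom θ = fullGain v E.prior * θ := by
  rw [value_toRandom, integral_congr_ae (E.indirect_ae_eq_full θ _),
    integral_V_posteriorLaw hv E.prior_mem _ hθ, gain_full]

end Environment

namespace Environment

variable {Ω : Type u} [MeasurableSpace Ω] [StandardBorelSpace Ω] [Nonempty Ω]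
  {E : Environment Ω} {v : ProbabilityMeasure Ω → ℝ}

/-! ### The type distribution in terms of its density -/

section TypeLaw

theorem integrableOn_density (E : Environment Ω) : IntegrableOn E.density (Icc E.lo E.hi) := by
  refine ⟨E.measurable_density.aestronglyMeasurable, ?_⟩
  rw [hasFiniteIntegral_iff_ofReal (Filter.Eventually.of_forall E.density_nonneg),
    E.lintegral_density]
  exact ENNReal.one_lt_top

theorem intervalIntegrable_density (E : Environment Ω) :
    IntervalIntegrable E.density volume E.lo E.hi :=
  (intervalIntegrable_iff_integrableOn_Icc_of_le E.lo_lt_hi.le).2 E.integrableOn_density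

theorem typeLaw_real (E : Environment Ω) {S : Set ℝ} (hS : MeasurableSet S) :
    E.typeLaw.real S = ∫ θ in S ∩ Icc E.lo E.hi, E.density θ := by
  rw [measureReal_def, typeLaw, withDensity_apply _ hS, types, Measure.restrict_restrict hS,
    integral_eq_lintegral_of_nonneg_ae (Filter.Eventually.of_forall E.density_nonneg)
      E.measurable_density.aestronglyMeasurable]

theorem typeLaw_real_Icc (E : Environment Ω) {r : ℝ} (hr : r ∈ Icc E.lo E.hi) :
    E.typeLaw.real (Icc r E.hi) = upperTail E.density E.hi r := by
  rw [E.typeLaw_real measurableSet_Icc, inter_eq_left.2 (Icc_subset_Icc_left hr.1),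
    integral_Icc_eq_integral_Ioc, upperTail, intervalIntegral.integral_of_le hr.2]

theorem upperTail_density_lo (E : Environment Ω) : upperTail E.density E.hi E.lo = 1 := by
  rw [upperTail, intervalIntegral.integral_of_le E.lo_lt_hi.le, ← integral_Icc_eq_integral_Ioc,
    integral_eq_lintegral_of_nonneg_ae (Filter.Eventually.of_forall E.density_nonneg)
      E.measurable_density.aestronglyMeasurable, E.lintegral_density]
  simp

theorem one_sub_typeLaw_real_Iic (E : Environment Ω) {x : ℝ} (hx : x ∈ Icc E.lo E.hi) :
    1 - E.typeLaw.real (Iic x) = upperTail E.density E.hi x := by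
  have e : Iic x ∩ Icc E.lo E.hi = Icc E.lo x := by
    ext y
    simp only [mem_inter_iff, mem_Iic, mem_Icc]
    exact ⟨fun h => ⟨h.2.1, h.1⟩, fun h => ⟨h.2, h.1, h.2.trans hx.2⟩⟩
  have hu : uIcc E.lo E.hi = Icc E.lo E.hi := uIcc_of_le E.lo_lt_hi.le
  have h := upperTail_sub_upperTail E.intervalIntegrable_density left_mem_uIcc (hu.symm ▸ hx)
  rw [E.upperTail_density_lo, intervalIntegral.integral_of_le hx.1] at h
  rw [E.typeLaw_real measurableSet_Iic, e, integral_Icc_eq_integral_Ioc]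
  linarith

theorem Regular.regularDensity (h : E.Regular) : RegularDensity E.density E.lo E.hi where
  lo_nonneg := E.lo_nonneg
  lo_lt_hi := E.lo_lt_hi
  integrable := E.intervalIntegrable_density
  pos := h.1
  tail_lo := E.upperTail_density_lo
  monotone := h.2.congr fun x hx => by
    rw [virtualValue, E.one_sub_typeLaw_real_Iic (Ioo_subset_Icc_self hx)]

instance isFiniteMeasure_typeLaw (E : Environment Ω) : IsFiniteMeasure E.typeLaw := by
  refine ⟨?_⟩
  rw [typeLaw, withDensity_apply _ MeasurableSet.univ, Measure.restrict_univ, types,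
    E.lintegral_density]
  exact ENNReal.one_lt_top

theorem typeLaw_absolutelyContinuous (E : Environment Ω) :
    E.typeLaw ≪ volume.restrict (Icc E.lo E.hi) := withDensity_absolutelyContinuous _ _

theorem integral_typeLaw (E : Environment Ω) (g : ℝ → ℝ) :
    ∫ θ, g θ ∂E.typeLaw = ∫ θ in E.lo..E.hi, g θ * E.density θ := by
  rw [typeLaw, integral_withDensity_eq_integral_toReal_smul
    E.measurable_density.ennreal_ofReal (Filter.Eventually.of_forall fun _ => ENNReal.ofReal_lt_top),
    intervalIntegral.integral_of_le E.lo_lt_hi.le, types, integral_Icc_eq_integral_Ioc]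
  refine integral_congr_ae (Filter.Eventually.of_forall fun θ => ?_)
  simp only [smul_eq_mul]
  rw [ENNReal.toReal_ofReal (E.density_nonneg θ), mul_comm]

theorem intervalIntegrable_of_integrable_typeLaw {g : ℝ → ℝ} (hg : Integrable g E.typeLaw) :
    IntervalIntegrable (fun θ => g θ * E.density θ) volume E.lo E.hi := by
  rw [typeLaw, integrable_withDensity_iff_integrable_smul'
    E.measurable_density.ennreal_ofReal
    (Filter.Eventually.of_forall fun _ => ENNReal.ofReal_lt_top)] at hg
  rw [intervalIntegrable_iff_integrableOn_Icc_of_le E.lo_lt_hi.le]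
  refine Integrable.congr hg (Filter.Eventually.of_forall fun θ => ?_)
  simp only [smul_eq_mul]
  rw [ENNReal.toReal_ofReal (E.density_nonneg θ), mul_comm]

end TypeLaw

/-! ### The revenue bound for implementable mechanisms -/

section Implementable

/-- The surplus over full information that is left on the table by `M`: the value of full
information minus the utility of the type. -/
noncomputable def netValue (E : Environment Ω) (v : ProbabilityMeasure Ω → ℝ) (M : Mechanism Ω)
    (θ : ℝ) : ℝ :=
  fullGain v E.prior * θ - (E.value (M.alloc θ) θ - M.pay θ)

variable {M : Mechanism Ω} (hv : E.Separable v) (hM : E.Implementable M)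
include hv hM

/-- A lower type can imitate a higher one, losing at most `fullGain v E.prior` per unit of type. -/
theorem netValue_mono : MonotoneOn (E.netValue v M) (Icc E.lo E.hi) := by
  intro θ hθ θ' hθ' h
  obtain ⟨⟨hdef, -⟩, hIC, -⟩ := hM
  have h1 := hIC θ hθ θ' hθ'
  have h2 := value_combination_le hv (a := 1) (b := -1) (c := 0) (d := θ' - θ) (e := 0)
    (hdef θ' hθ' θ' hθ') (hdef θ hθ θ' hθ') (hdef θ hθ θ' hθ') le_rfl fun μ hμ => by
      have := indirect_sub_le hv hμ hθ hθ' h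
      linarith
  simp only [netValue]
  linarith

/-- For the upper slope bound, the higher type imitates the lower one and gains at least `v E.prior`
per unit of type. -/
theorem netValue_lipschitz :
    LipschitzOnWith (fullGain v E.prior - v E.prior).toNNReal (E.netValue v M)
      (Icc E.lo E.hi) := by
  have hmono := netValue_mono hv hM
  obtain ⟨⟨hdef, -⟩, hIC, -⟩ := hM
  have key : ∀ θ ∈ Icc E.lo E.hi, ∀ θ' ∈ Icc E.lo E.hi, θ ≤ θ' →
      E.netValue v M θ' ≤ E.netValue v M θ + (fullGain v E.prior - v E.prior) * (θ' - θ) := by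
    intro θ hθ θ' hθ' h
    have h1 := hIC θ' hθ' θ hθ
    have h2 := value_combination_le hv (a := 1) (b := -1) (c := 0) (d := 0) (e := θ' - θ)
      (hdef θ hθ θ hθ) (hdef θ' hθ' θ hθ) (hdef θ hθ θ hθ) (sub_nonneg.2 h) fun μ hμ => by
        have := le_indirect_sub hv hμ hθ hθ' h
        linarith
    simp only [netValue]
    linarith
  refine LipschitzOnWith.of_le_add_mul _ fun x hx y hy => ?_
  rw [Real.coe_toNNReal _ (sub_nonneg.2 (le_fullGain hv E.prior_mem)), Real.dist_eq]
  rcases le_total x y with h | h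
  · have := hmono hx hy h
    have h0 := mul_nonneg (sub_nonneg.2 (le_fullGain hv E.prior_mem)) (abs_nonneg (x - y))
    linarith
  · rw [abs_of_nonneg (sub_nonneg.2 h)]
    exact key y hy x hx h

/-- The utility is the maximum over reports of functions that are convex in the true type. -/
theorem netValue_concave : ConcaveOn ℝ (Icc E.lo E.hi) (E.netValue v M) := by
  obtain ⟨⟨hdef, -⟩, hIC, -⟩ := hM
  refine ⟨convex_Icc _ _, fun x hx y hy a b ha hb hab => ?_⟩
  have hz : a * x + b * y ∈ E.types := convex_Icc E.lo E.hi hx hy ha hb hab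
  have h1 := mul_le_mul_of_nonneg_left (hIC x hx _ hz) ha
  have h2 := mul_le_mul_of_nonneg_left (hIC y hy _ hz) hb
  have h3 := value_combination_le hv (a := 1) (b := -a) (c := -b) (d := 0) (e := 0)
    (hdef _ hz _ hz) (hdef x hx _ hz) (hdef y hy _ hz) le_rfl fun μ hμ => by
      have := indirect_convex hv hμ hx hy ha hb hab
      linarith
  have h4 : M.pay (a * x + b * y) = a * M.pay (a * x + b * y) + b * M.pay (a * x + b * y) := by
    rw [← add_mul, hab, one_mul]
  simp only [netValue, smul_eq_mul]
  linarith

/-- The payment of a type is at most its virtual contribution: experiments that she conducts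
herself only cost surplus. -/
theorem pay_le {θ : ℝ} (hθ : θ ∈ Ioo E.lo E.hi) (hd : DifferentiableAt ℝ (E.netValue v M) θ) :
    M.pay θ ≤ E.netValue v M θ - θ * deriv (E.netValue v M) θ := by
  obtain ⟨⟨hdef, -⟩, hIC, -⟩ := hM
  have h0 : 0 < θ := E.lo_nonneg.trans_lt hθ.1
  have hθI : θ ∈ E.types := Ioo_subset_Icc_self hθ
  have hder : deriv (E.netValue v M) θ ≤ fullGain v E.prior - E.value (M.alloc θ) θ / θ := by
    have ht := (hasDerivWithinAt_iff_tendsto_slope' (self_notMem_Ioi (a := θ))).1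
      (hd.hasDerivAt.hasDerivWithinAt (s := Ioi θ))
    -- Right difference quotients suffice: each is bounded by letting a type slightly above `θ`
    -- imitate `θ`, whose allocation is worth at least `θ' / θ` times as much to her.
    refine le_of_tendsto ht ?_
    filter_upwards [Ioo_mem_nhdsGT hθ.2] with θ' hθ'
    have hθ'I : θ' ∈ E.types := ⟨(hθ.1.trans hθ'.1).le, hθ'.2.le⟩
    have h1 := hIC θ' hθ'I θ hθI
    have h2 := value_combination_le hv (a := θ') (b := -θ) (c := 0) (d := 0) (e := 0)
      (hdef θ hθI θ hθI) (hdef θ' hθ'I θ hθI) (hdef θ hθI θ hθI) le_rfl fun μ hμ => by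
        have := mul_indirect_le hv hμ hθI hθ'I h0 hθ'.1.le
        linarith
    rw [slope_def_field, div_le_iff₀ (sub_pos.2 hθ'.1)]
    have h3 : E.value (M.alloc θ) θ / θ * (θ' - θ) + E.value (M.alloc θ) θ ≤
        E.value (M.alloc θ) θ' := by
      have : E.value (M.alloc θ) θ / θ * (θ' - θ) + E.value (M.alloc θ) θ =
          E.value (M.alloc θ) θ * θ' / θ := by field_simp; ring
      rw [this, div_le_iff₀ h0]
      linarith
    simp only [netValue]
    linarith
  have h4 := mul_le_mul_of_nonneg_left hder h0.le
  rw [mul_sub, mul_div_cancel₀ _ h0.ne'] at h4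
  simp only [netValue] at h4 ⊢
  linarith

/-- An upper bound for the revenue of every implementable mechanism in terms of the monopoly
revenue of the type distribution. -/
theorem revenue_le (hReg : E.Regular) {m : ℝ} (hm : m ∈ Icc E.lo E.hi)
    (hmax : ∀ x ∈ Icc E.lo E.hi,
      x * upperTail E.density E.hi x ≤ m * upperTail E.density E.hi m) :
    E.revenue M ≤ fullGain v E.prior * (m * upperTail E.density E.hi m) -
      E.indirect E.prior (m * upperTail E.density E.hi m) := by
  have h := hReg.regularDensity
  have hK := netValue_lipschitz hv hM
  obtain ⟨hint, hle⟩ := h.integral_virtual_le hm hmax (netValue_concave hv hM)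
    (netValue_mono hv hM) hK
  have hr := h.reserve_revenue_mem hm hmax
  have hIR := hM.2.2 (m * upperTail E.density E.hi m) ⟨hr.1, hr.2.trans hm.2⟩
  have hAC : AbsolutelyContinuousOnInterval (E.netValue v M) E.lo E.hi :=
    LipschitzOnWith.absolutelyContinuousOnInterval (h.uIcc_eq ▸ hK)
  have hpay : ∫ θ in E.lo..E.hi, M.pay θ * E.density θ ≤
      ∫ θ in E.lo..E.hi, (E.netValue v M θ - θ * deriv (E.netValue v M) θ) * E.density θ := by
    refine intervalIntegral.integral_mono_ae_restrict E.lo_lt_hi.le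
      (intervalIntegrable_of_integrable_typeLaw hM.1.2) hint ?_
    rw [Filter.EventuallyLE, ← restrict_Ioo_eq_restrict_Icc, ae_restrict_iff' measurableSet_Ioo]
    filter_upwards [hAC.ae_differentiableAt] with θ hd hθ
    rw [h.uIcc_eq] at hd
    exact mul_le_mul_of_nonneg_right (pay_le hv hM hθ (hd (Ioo_subset_Icc_self hθ)))
      (E.density_nonneg θ)
  rw [revenue, E.integral_typeLaw]
  refine (hpay.trans hle).trans ?_
  simp only [netValue]
  linarith

end Implementable

/-! ### Posted prices for full information -/

section PostedPrice

/-- The types that buy full information at the price `t`. -/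
def buyers (E : Environment Ω) (v : ProbabilityMeasure Ω → ℝ) (t : ℝ) : Set ℝ :=
  {θ | θ ∈ Icc E.lo E.hi ∧ E.indirect E.prior θ ≤ fullGain v E.prior * θ - t}

theorem buyers_upward (hv : E.Separable v) {t θ θ' : ℝ} (hθ : θ ∈ E.buyers v t)
    (hθ' : θ' ∈ Icc E.lo E.hi) (h : θ ≤ θ') : θ' ∈ E.buyers v t := by
  have h1 := indirect_sub_le hv E.prior_mem hθ.1 hθ' h
  exact ⟨hθ', by linarith [hθ.2]⟩

/-- Buyers form an upward closed part of an interval, hence an order-connected set. -/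
theorem measurableSet_buyers (hv : E.Separable v) (t : ℝ) : MeasurableSet (E.buyers v t) :=
  OrdConnected.measurableSet ⟨fun _ hx _ hy _ hz =>
    buyers_upward hv hx ⟨hx.1.1.trans hz.1, hz.2.trans hy.1.2⟩ hz.1⟩

theorem postedPrice_pay_ae_eq (hv : E.Separable v) (t : ℝ) :
    (E.postedPrice t).pay =ᵐ[E.typeLaw] (E.buyers v t).indicator fun _ => t := by
  refine E.typeLaw_absolutelyContinuous.ae_le ?_
  filter_upwards [ae_restrict_mem measurableSet_Icc] with θ hθ
  simp only [postedPrice, value_full hv hθ, indicator, buyers, mem_ofPred_eq, hθ, true_and]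

theorem postedPrice_revenue (hv : E.Separable v) (t : ℝ) :
    E.revenue (E.postedPrice t) = E.typeLaw.real (E.buyers v t) * t := by
  rw [revenue, integral_congr_ae (postedPrice_pay_ae_eq hv t),
    integral_indicator_const _ (measurableSet_buyers hv t), smul_eq_mul]

/-- Every type picks the better of two options, and the null option is worth exactly her outside
option. -/
theorem implementable_postedPrice (hv : E.Separable v) (t : ℝ) :
    E.Implementable (E.postedPrice t) := by
  refine ⟨⟨fun θ hθ θ' _ => ?_, ?_⟩, fun θ hθ θ' _ => ?_, fun θ hθ => ?_⟩
  · simp only [postedPrice]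
    split_ifs
    exacts [valueDefined_full hθ, valueDefined_null θ]
  · exact (((integrable_const t).indicator (measurableSet_buyers hv t)).congr
      (postedPrice_pay_ae_eq hv t).symm)
  · simp only [postedPrice]
    split_ifs <;> (try rw [value_null]) <;> linarith
  · simp only [postedPrice]
    split_ifs <;> (try rw [value_null]) <;> linarith

end PostedPrice

end Environment

end InfoSale

/-- For convex separable valuations, under the sequential learning assumption and regularity, some
posted price for full information is an implementable mechanism whose revenue is at least half of
the (finite) optimal revenue. -/
theorem theorem3 {Ω : Type u} [MeasurableSpace Ω] [StandardBorelSpace Ω] [Nonempty Ω]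
    (E : InfoSale.Environment Ω) (hV : E.ConvexSeparable) (hSeq : E.SequentialLearning)
    (hReg : E.Regular) :
    ∃ t : ℝ, E.Implementable (E.postedPrice t) ∧ BddAbove E.revenues ∧
      E.optimalRevenue / 2 ≤ E.revenue (E.postedPrice t) := by
  obtain ⟨v, hv, -⟩ := hV
  replace hv : E.Separable v := hv
  have h := hReg.regularDensity
  obtain ⟨m, hm, hmax⟩ := h.exists_reserve
  have hhalf := h.half_le_tail_reserve_revenue hm hmax
  have hrm := h.reserve_revenue_mem hm hmax
  have hbound : ∀ M, E.Implementable M → _ := fun M hM =>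
    InfoSale.Environment.revenue_le hv hM hReg hm hmax
  set r := m * InfoSale.upperTail E.density E.hi m
  have hr : r ∈ Icc E.lo E.hi := ⟨hrm.1, hrm.2.trans hm.2⟩
  -- The price that makes type `r` indifferent between buying and her outside option.
  set t := InfoSale.Environment.fullGain v E.prior * r - E.indirect E.prior r with ht
  have ht0 : 0 ≤ t := sub_nonneg.2
    (InfoSale.Environment.indirect_le_fullGain_mul hv E.prior_mem hr)
  have himp := InfoSale.Environment.implementable_postedPrice hv t
  have hub : ∀ x ∈ E.revenues, x ≤ t := by
    rintro _ ⟨M, hM, rfl⟩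
    exact hbound M hM
  refine ⟨t, himp, ⟨t, hub⟩, ?_⟩
  have hopt : E.optimalRevenue ≤ t := csSup_le ⟨_, _, himp, rfl⟩ hub
  have hrb : r ∈ E.buyers v t := ⟨hr, by rw [ht]; linarith⟩
  have hsub : Icc r E.hi ⊆ E.buyers v t := fun θ hθ =>
    InfoSale.Environment.buyers_upward hv hrb ⟨hr.1.trans hθ.1, hθ.2⟩ hθ.1
  have hprob : 1 / 2 ≤ E.typeLaw.real (E.buyers v t) :=
    (hhalf.trans_eq (E.typeLaw_real_Icc hr).symm).trans (measureReal_mono hsub)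
  rw [InfoSale.Environment.postedPrice_revenue hv]
  nlinarith
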